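/- Let $X$ be a complete separable metric space, let $\mathcal{P}(X)$ be the space of Borel probability measures on $X$ with the weak topology (generated by the functions $\mu\mapsto\int_X f\,d\mu$, $f\in C_b(X)$), and let $\lambda$ be Lebesgue measure on $[0,1]$. Then one can choose, for every $\mu\in\mathcal{P}(X)$, a Borel mapping $\xi_\mu\colon[0,1]\to X$ with $\lambda\circ\xi_\mu^{-1}=\mu$ such that the following assertions hold. (1) The mapping $(\mu,t)\mapsto\xi_\mu(t)$ is Borel measurable on $\mathcal{P}(X)\times[0,1]$. (2) For every sequence $(\mu_n)_{n\in\mathbb{N}}$ in $\mathcal{P}(X)$ and every $\mu\in\mathcal{P}(X)$, the measures $\mu_n$ converge weakly to $\mu$ if and only if $\xi_{\mu_n}(t)\to\xi_\mu(t)$ for $\lambda$-almost every $t\in[0,1]$. (3) For every measurable space $(\Omega,\mathcal{A})$ and every family $(\mu_\omega)_{\omega\in\Omega}$ in $\mathcal{P}(X)$ that depends measurably on $\omega$ (that is, $\omega\mapsto\mu_\omega(B)$ is $\mathcal{A}$-measurable for every Borel set $B\subset X$), the mapping $(\omega,t)\mapsto\xi_{\mu_\omega}(t)$ from $\Omega\times[0,1]$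 to $X$ is $\mathcal{A}\otimes\mathcal{B}([0,1])$-measurable. -/

import Mathlib

open MeasureTheory Filter Topology
open scoped unitInterval

/-! On `I` the quantile functions do everything, so `X` is coded into `I` by recording membership in
countably many balls. The code has a continuous inverse on its image, but is discontinuous on the
ball boundaries, which some measures charge. Scaling all radii by `1 + r` cures this: for each `μ`,
almost every `r` makes every boundary `μ`-null (`ae_ae_continuousAt_ballCode`). Then weak
convergence passes to the coded laws, their quantiles converge a.e. (`ae_tendsto_unitQuantile_map`),
and decoding preserves the convergence (`tendsto_of_tendsto_ballCode`). Since the good `r` depend on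
`μ`, `r` is kept as a second random coordinate, and `I × I` is parametrized by `I`. -/

/-- The quantile function of a measure on the unit interval. -/
noncomputable def unitQuantile (ν : Measure I) (t : I) : I :=
  sInf {y | ENNReal.ofReal t ≤ ν (Set.Iic y)}

/-- The infimum is attained, by right continuity of the distribution function; at `1`, where nothing
lies to the right, the total mass is used. -/
theorem unitQuantile_le_iff (ν : Measure I) [IsProbabilityMeasure ν] (t y : I) :
    unitQuantile ν t ≤ y ↔ ENNReal.ofReal t ≤ ν (Set.Iic y) := by
  refine ⟨fun h => ?_, fun h => sInf_le h⟩
  refine le_trans ?_ (measure_mono (Set.Iic_subset_Iic.2 h))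
  set q := unitQuantile ν t with hq
  have hgt : ∀ z, q < z → ENNReal.ofReal t ≤ ν (Set.Iic z) := by
    intro z hz
    obtain ⟨w, hw, hwz⟩ := sInf_lt_iff.1 hz
    exact le_trans hw (measure_mono (Set.Iic_subset_Iic.2 hwz.le))
  rcases eq_or_lt_of_le (unitInterval.le_one' (t := q)) with h1 | h1
  · rw [h1, show Set.Iic (1 : I) = Set.univ from Set.Iic_top, measure_univ]
    exact ENNReal.ofReal_le_one.2 t.2.2
  · have hlim := tendsto_measure_biInter_gt (μ := ν) (s := fun z : I => Set.Iic z) (a := q)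
      (fun r _ => measurableSet_Iic.nullMeasurableSet)
      (fun i j _ hij => Set.Iic_subset_Iic.2 hij) ⟨1, h1, measure_ne_top _ _⟩
    have hI : (⋂ r > q, Set.Iic r) = Set.Iic q := by
      ext z
      simp only [Set.mem_iInter, Set.mem_Iic]
      exact ⟨fun h => le_of_forall_gt_imp_ge_of_dense h, fun h r hr => h.trans hr.le⟩
    rw [hI] at hlim
    have : (𝓝[>] q).NeBot := nhdsGT_neBot_of_exists_gt ⟨1, h1⟩
    exact ge_of_tendsto hlim (eventually_nhdsWithin_of_forall hgt)

theorem lt_unitQuantile_iff (ν : Measure I) [IsProbabilityMeasure ν] (t y : I) :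
    y < unitQuantile ν t ↔ ν (Set.Iic y) < ENNReal.ofReal t := by
  rw [← not_le, unitQuantile_le_iff, not_le]

theorem unitQuantile_mono (ν : Measure I) : Monotone (unitQuantile ν) := fun _ _ h =>
  sInf_le_sInf fun _ hy => (ENNReal.ofReal_le_ofReal h).trans hy

theorem map_unitQuantile (ν : Measure I) [IsProbabilityMeasure ν] :
    (volume : Measure I).map (unitQuantile ν) = ν := by
  have hm : Measurable (unitQuantile ν) := (unitQuantile_mono ν).measurable
  have := Measure.isProbabilityMeasure_map (μ := (volume : Measure I)) hm.aemeasurable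
  refine Measure.ext_of_Iic _ _ fun y => ?_
  rw [Measure.map_apply hm measurableSet_Iic]
  have hy : (ν (Set.Iic y)).toReal ∈ I := ⟨ENNReal.toReal_nonneg, measureReal_le_one⟩
  have : unitQuantile ν ⁻¹' Set.Iic y = Set.Iic (⟨(ν (Set.Iic y)).toReal, hy⟩ : I) := by
    ext t
    rw [Set.mem_preimage, Set.mem_Iic, unitQuantile_le_iff,
      ENNReal.ofReal_le_iff_le_toReal (measure_ne_top _ _)]
    rfl
  rw [this, unitInterval.volume_Iic, ENNReal.ofReal_toReal (measure_ne_top _ _)]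

theorem measurable_unitQuantile {Ω : Type*} [MeasurableSpace Ω] {ν : Ω → Measure I}
    [∀ ω, IsProbabilityMeasure (ν ω)] (hν : ∀ y, Measurable fun ω => ν ω (Set.Iic y)) :
    Measurable fun p : Ω × I => unitQuantile (ν p.1) p.2 := by
  refine measurable_of_Iic fun y => ?_
  have : (fun p : Ω × I => unitQuantile (ν p.1) p.2) ⁻¹' Set.Iic y =
      {p | ENNReal.ofReal p.2 ≤ ν p.1 (Set.Iic y)} := by
    ext p
    exact unitQuantile_le_iff _ _ _
  rw [this]
  exact measurableSet_le (ENNReal.measurable_ofReal.comp (measurable_subtype_coe.comp measurable_snd))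
    ((hν y).comp measurable_fst)

theorem countable_pos_singleton (ν : Measure I) [IsProbabilityMeasure ν] :
    {y : I | 0 < ν {y}}.Countable :=
  Measure.countable_meas_pos_of_disjoint_iUnion (fun y => measurableSet_singleton y)
    fun _ _ h => Set.disjoint_singleton.2 h

theorem exists_null_singleton_between (ν : Measure I) [IsProbabilityMeasure ν] {a b : I}
    (hab : a < b) : ∃ y, a < y ∧ y < b ∧ ν {y} = 0 := by
  have h0 := (countable_pos_singleton ν).measure_zero (volume : Measure I)
  have h1 : 0 < (volume : Measure I) (Set.Ioo a b \ {y : I | 0 < ν {y}}) := by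
    rw [measure_sdiff_null h0, unitInterval.volume_Ioo]
    exact ENNReal.ofReal_pos.2 (sub_pos.2 hab)
  obtain ⟨y, hy, hy'⟩ := nonempty_of_measure_ne_zero h1.ne'
  exact ⟨y, hy.1, hy.2, by simpa using hy'⟩

/-- Convergence of distribution functions off the atoms of the limit implies almost everywhere
convergence of quantile functions. -/
theorem ae_tendsto_unitQuantile {νs : ℕ → Measure I} {ν : Measure I}
    [∀ n, IsProbabilityMeasure (νs n)] [IsProbabilityMeasure ν]
    (h : ∀ y, ν {y} = 0 → Tendsto (fun n => νs n (Set.Iic y)) atTop (𝓝 (ν (Set.Iic y)))) :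
    ∀ᵐ t ∂(volume : Measure I),
      Tendsto (fun n => unitQuantile (νs n) t) atTop (𝓝 (unitQuantile ν t)) := by
  have hcont := (unitQuantile_mono ν).countable_not_continuousAt.ae_notMem (volume : Measure I)
  have hone := (Set.countable_singleton (1 : I)).ae_notMem (volume : Measure I)
  filter_upwards [hcont, hone] with t ht ht1
  replace ht : ContinuousAt (unitQuantile ν) t := not_not.1 ht
  replace ht1 : t < 1 := lt_of_le_of_ne unitInterval.le_one' ht1
  refine tendsto_order.2 ⟨fun a ha => ?_, fun b hb => ?_⟩
  · obtain ⟨y, hay, hy, hy0⟩ := exists_null_singleton_between ν ha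
    filter_upwards [(h y hy0).eventually_lt_const ((lt_unitQuantile_iff _ _ _).1 hy)] with n hn
    exact hay.trans ((lt_unitQuantile_iff _ _ _).2 hn)
  · obtain ⟨y, hy, hyb, hy0⟩ := exists_null_singleton_between ν hb
    have : (𝓝[>] t).NeBot := nhdsGT_neBot_of_exists_gt ⟨1, ht1⟩
    -- Continuity at `t` lets some `s > t` still have quantile below `y`; this makes the inequality
    -- at `t` strict, so it survives the limit.
    obtain ⟨s, hs, hts⟩ := (((ht.eventually_lt_const hy).filter_mono
      (nhdsWithin_le_nhds (s := Set.Ioi t))).and self_mem_nhdsWithin).exists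
    have hlt : ENNReal.ofReal t < ν (Set.Iic y) :=
      lt_of_lt_of_le ((ENNReal.ofReal_lt_ofReal_iff_of_nonneg t.2.1).2 hts)
        ((unitQuantile_le_iff _ _ _).1 hs.le)
    filter_upwards [(h y hy0).eventually_const_lt hlt] with n hn
    exact ((unitQuantile_le_iff _ _ _).2 hn.le).trans_lt hyb

/-! ### Images of weakly convergent sequences -/

theorem frontier_preimage_Iic_subset {X : Type*} [TopologicalSpace X] (f : X → I) (y : I) :
    frontier (f ⁻¹' Set.Iic y) ⊆ {x | ¬ ContinuousAt f x} ∪ f ⁻¹' {y} := by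
  intro x hx
  by_contra hcon
  simp only [Set.mem_union, Set.mem_ofPred_eq, not_or, not_not, Set.mem_preimage,
    Set.mem_singleton_iff] at hcon
  obtain ⟨hc, hne⟩ := hcon
  rcases lt_or_gt_of_ne hne with hlt | hgt
  · refine hx.2 (mem_interior_iff_mem_nhds.2 ?_)
    filter_upwards [hc.eventually_lt_const hlt] with z hz using hz.le
  · have h2 : ∀ᶠ z in 𝓝 x, y < f z := hc.eventually_const_lt hgt
    obtain ⟨z, hz, hz'⟩ := ((mem_closure_iff_frequently.1 hx.1).and_eventually h2).exists
    exact (lt_of_lt_of_le hz' hz).false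

/-- Almost everywhere convergence of the quantile functions of the images of a weakly convergent
sequence under an almost everywhere continuous function. -/
theorem ae_tendsto_unitQuantile_map {X : Type*} [TopologicalSpace X] [HasOuterApproxClosed X]
    [MeasurableSpace X] [OpensMeasurableSpace X] {μs : ℕ → ProbabilityMeasure X}
    {μ : ProbabilityMeasure X} (hμ : Tendsto μs atTop (𝓝 μ)) {f : X → I} (hf : Measurable f)
    (hfc : ∀ᵐ x ∂(μ : Measure X), ContinuousAt f x) :
    ∀ᵐ t ∂(volume : Measure I),
      Tendsto (fun n => unitQuantile ((μs n : Measure X).map f) t) atTop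
        (𝓝 (unitQuantile ((μ : Measure X).map f) t)) := by
  have := fun n => Measure.isProbabilityMeasure_map (μ := (μs n : Measure X)) hf.aemeasurable
  have := Measure.isProbabilityMeasure_map (μ := (μ : Measure X)) hf.aemeasurable
  refine ae_tendsto_unitQuantile fun y hy => ?_
  rw [Measure.map_apply hf (measurableSet_singleton y)] at hy
  simp only [Measure.map_apply hf measurableSet_Iic]
  exact ProbabilityMeasure.tendsto_measure_of_null_frontier_of_tendsto' hμ
    (measure_mono_null (frontier_preimage_Iic_subset f y)
      (measure_union_null (ae_iff.1 hfc) hy))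

/-! ### Coding points by randomly scaled balls -/

/-- The embedding of the Cantor space onto the ternary Cantor set in the unit interval. -/
noncomputable def cantorEmb (b : ℕ → Bool) : I :=
  Set.inclusion cantorSet_subset_unitInterval (cantorSetHomeomorphNatToBool.symm b)

theorem isEmbedding_cantorEmb : IsEmbedding cantorEmb :=
  (IsEmbedding.inclusion cantorSet_subset_unitInterval).comp
    cantorSetHomeomorphNatToBool.symm.isEmbedding

section BallCode

variable {X : Type*} [MetricSpace X] [TopologicalSpace.SeparableSpace X] [Nonempty X]

/-- The ball with the `k`-th centre and radius, with radii scaled by `1 + r`. -/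
noncomputable def codeBall (r : I) (k : ℕ) : Set X :=
  Metric.ball (TopologicalSpace.denseSeq X k.unpair.1) ((1 + r) * (2⁻¹ : ℝ) ^ k.unpair.2)

open Classical in
/-- The point of the Cantor set that records which of the balls `codeBall r k` contain `x`. -/
noncomputable def ballCode (p : I × X) : I :=
  cantorEmb fun k => decide (p.2 ∈ codeBall p.1 k)

/-- Code digits are discrete, so `u n` eventually enters each coded ball around `x`, and such balls
can be arbitrarily small. -/
theorem tendsto_of_tendsto_ballCode {r : I} {x : X} {u : ℕ → X}
    (h : Tendsto (fun n => ballCode (r, u n)) atTop (𝓝 (ballCode (r, x)))) :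
    Tendsto u atTop (𝓝 x) := by
  have h1 := tendsto_pi_nhds.1 (isEmbedding_cantorEmb.tendsto_nhds_iff.2 h)
  rw [Metric.tendsto_atTop']
  intro ε hε
  -- Radii are at most `2 * 2⁻¹ ^ j`, so two points of one ball are less than `4 * 2⁻¹ ^ j` apart.
  obtain ⟨j, hj⟩ := exists_pow_lt_of_lt_one (show 0 < ε / 4 by positivity)
    (show (2⁻¹ : ℝ) < 1 by norm_num)
  have hjpos : (0 : ℝ) < 2⁻¹ ^ j := by positivity
  obtain ⟨i, hi⟩ := (TopologicalSpace.denseRange_denseSeq X).exists_dist_lt x hjpos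
  have hr0 := r.2.1
  have hr1 := r.2.2
  have hx : x ∈ codeBall r (Nat.pair i j) := by
    simp only [codeBall, Nat.unpair_pair, Metric.mem_ball]
    nlinarith
  have h2 := h1 (Nat.pair i j)
  rw [nhds_discrete, tendsto_pure] at h2
  obtain ⟨N, hN⟩ := eventually_atTop.1 h2
  refine ⟨N, fun n hn => ?_⟩
  have h3 := hN n hn.le
  simp only [hx, decide_true, decide_eq_true_eq] at h3
  simp only [codeBall, Nat.unpair_pair, Metric.mem_ball] at h3
  have := dist_triangle_right (u n) x (TopologicalSpace.denseSeq X i)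
  nlinarith

theorem ballCode_injective (r : I) : Function.Injective fun x : X => ballCode (r, x) := by
  intro x y hxy
  have : Tendsto (fun _ : ℕ => x) atTop (𝓝 y) :=
    tendsto_of_tendsto_ballCode (r := r) (by simp only [hxy]; exact tendsto_const_nhds)
  exact tendsto_nhds_unique tendsto_const_nhds this

open Classical in
theorem continuousAt_ballCode {r : I} {x : X} (h : ∀ k, x ∉ frontier (codeBall (X := X) r k)) :
    ContinuousAt (fun x => ballCode (r, x)) x := by
  refine isEmbedding_cantorEmb.continuous.continuousAt.comp (continuousAt_pi.2 fun k => ?_)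
  refine ContinuousAt.congr (f := fun _ => decide (x ∈ codeBall r k)) continuousAt_const ?_
  have hopen : IsOpen (codeBall (X := X) r k) := Metric.isOpen_ball
  by_cases hx : x ∈ codeBall r k
  · filter_upwards [hopen.mem_nhds hx] with z hz
    simp only [hx, hz]
  · have : x ∉ closure (codeBall r k) := fun hc => h k ⟨hc, by rwa [hopen.interior_eq]⟩
    filter_upwards [isClosed_closure.isOpen_compl.mem_nhds this] with z hz
    have : z ∉ codeBall r k := fun hz' => hz (subset_closure hz')
    simp only [hx, this]

variable [MeasurableSpace X] [BorelSpace X]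

open Classical in
theorem measurable_ballCode : Measurable (ballCode : I × X → I) := by
  have : SecondCountableTopology X := UniformSpace.secondCountable_of_separable X
  refine isEmbedding_cantorEmb.continuous.measurable.comp (measurable_pi_lambda _ fun k => ?_)
  refine measurable_to_bool ?_
  have : (fun p : I × X => decide (p.2 ∈ codeBall p.1 k)) ⁻¹' {true} =
      {p | dist p.2 (TopologicalSpace.denseSeq X k.unpair.1) <
        (1 + (p.1 : ℝ)) * (2⁻¹ : ℝ) ^ k.unpair.2} := by
    ext p
    simp [codeBall]
  rw [this]
  exact measurableSet_lt (by fun_prop) (by fun_prop)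

theorem measurable_ballCode_right (r : I) : Measurable fun x : X => ballCode (r, x) :=
  measurable_ballCode.comp measurable_prodMk_left

/-- For fixed `k` the frontiers lie on concentric spheres of distinct radii, hence are disjoint, and
only countably many can have positive mass. -/
theorem ae_ae_continuousAt_ballCode (μ : Measure X) [IsProbabilityMeasure μ] :
    ∀ᵐ r ∂(volume : Measure I), ∀ᵐ x ∂μ, ContinuousAt (fun x => ballCode (r, x)) x := by
  have key : ∀ k, ∀ᵐ r ∂(volume : Measure I), μ (frontier (codeBall (X := X) r k)) = 0 := by
    intro k
    have hdis : Pairwise (Function.onFun Disjoint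
        fun r : I => frontier (codeBall (X := X) r k)) := by
      intro r s hrs
      refine Set.disjoint_left.2 fun x hx hx' => hrs ?_
      have h1 := Metric.frontier_ball_subset_sphere hx
      have h2 := Metric.frontier_ball_subset_sphere hx'
      rw [Metric.mem_sphere] at h1 h2
      have h3 := mul_right_cancel₀ (by positivity) (h1.symm.trans h2)
      exact Subtype.ext (add_left_cancel h3)
    have := Measure.countable_meas_pos_of_disjoint_iUnion (μ := μ)
      (fun r : I => (isClosed_frontier (s := codeBall (X := X) r k)).measurableSet) hdis
    filter_upwards [this.ae_notMem (volume : Measure I)] with r hr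
    simpa using hr
  filter_upwards [ae_all_iff.2 key] with r hr
  have : ∀ᵐ x ∂μ, ∀ k, x ∉ frontier (codeBall (X := X) r k) :=
    ae_all_iff.2 fun k => measure_eq_zero_iff_ae_notMem.1 (hr k)
  filter_upwards [this] with x hx using continuousAt_ballCode hx

/-- Lusin–Souslin: an injective Borel map between standard Borel spaces is a measurable embedding.
Completeness enters here. -/
theorem exists_measurable_ballDecode [CompleteSpace X] :
    ∃ G : I × I → X, Measurable G ∧ ∀ r x, G (r, ballCode (r, x)) = x := by
  have : SecondCountableTopology X := UniformSpace.secondCountable_of_separable X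
  have hm : Measurable fun p : I × X => (p.1, ballCode p) :=
    measurable_fst.prodMk measurable_ballCode
  have hinj : Function.Injective fun p : I × X => (p.1, ballCode p) := by
    rintro ⟨r, x⟩ ⟨s, y⟩ h
    obtain ⟨rfl, h2⟩ := Prod.mk.inj h
    exact Prod.ext rfl (ballCode_injective r h2)
  obtain ⟨G, hG, hGe⟩ := (hm.measurableEmbedding hinj).exists_measurable_extend
    (measurable_snd (α := I) (β := X)) fun _ => inferInstance
  exact ⟨G, hG, fun r x => congrFun hGe (r, x)⟩

instance isProbabilityMeasure_map_ballCode (μ : Measure X) [IsProbabilityMeasure μ] (r : I) :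
    IsProbabilityMeasure (μ.map fun x => ballCode (r, x)) :=
  Measure.isProbabilityMeasure_map (measurable_ballCode_right r).aemeasurable

theorem measurable_map_ballCode_Iic {Ω : Type*} [MeasurableSpace Ω]
    {m : Ω → ProbabilityMeasure X}
    (hm : ∀ B : Set X, MeasurableSet B → Measurable fun ω => (m ω : Measure X) B) (y : I) :
    Measurable fun p : Ω × I =>
      ((m p.1 : Measure X).map fun x => ballCode (p.2, x)) (Set.Iic y) := by
  have hκ : Measurable fun p : Ω × I => (m p.1 : Measure X) :=
    (Measure.measurable_of_measurable_coe _ hm).comp measurable_fst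
  have : ProbabilityTheory.IsMarkovKernel (⟨_, hκ⟩ : ProbabilityTheory.Kernel (Ω × I) X) :=
    ⟨fun p => (m p.1).2⟩
  have hS : MeasurableSet {z : (Ω × I) × X | ballCode (z.1.2, z.2) ≤ y} :=
    measurableSet_le (measurable_ballCode.comp
      ((measurable_snd.comp measurable_fst).prodMk measurable_snd)) measurable_const
  have h1 := ProbabilityTheory.Kernel.measurable_kernel_prodMk_left
    (κ := (⟨_, hκ⟩ : ProbabilityTheory.Kernel (Ω × I) X)) hS
  have h2 : (fun p : Ω × I => ((m p.1 : Measure X).map fun x => ballCode (p.2, x)) (Set.Iic y)) =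
      fun p => (m p.1 : Measure X)
        (Prod.mk p ⁻¹' {z : (Ω × I) × X | ballCode (z.1.2, z.2) ≤ y}) :=
    funext fun p => Measure.map_apply (measurable_ballCode_right _) measurableSet_Iic
  rw [h2]
  exact h1

theorem measurable_unitQuantile_map_ballCode {Ω : Type*} [MeasurableSpace Ω]
    {m : Ω → ProbabilityMeasure X}
    (hm : ∀ B : Set X, MeasurableSet B → Measurable fun ω => (m ω : Measure X) B) :
    Measurable fun p : Ω × (I × I) =>
      unitQuantile ((m p.1 : Measure X).map fun x => ballCode (p.2.1, x)) p.2.2 := by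
  have hP (q : Ω × I) : IsProbabilityMeasure ((m q.1 : Measure X).map fun x => ballCode (q.2, x)) :=
    isProbabilityMeasure_map_ballCode _ _
  have h := measurable_unitQuantile
    (ν := fun q : Ω × I => (m q.1 : Measure X).map fun x => ballCode (q.2, x))
    (measurable_map_ballCode_Iic hm)
  have hp : Measurable fun p : Ω × (I × I) => ((p.1, p.2.1), p.2.2) :=
    (measurable_fst.prodMk (measurable_fst.comp measurable_snd)).prodMk
      (measurable_snd.comp measurable_snd)
  have hc := h.comp hp
  rw [Function.comp_def] at hc
  exact hc

/-- The parametrization of `μ` obtained by decoding, through `G`, the quantile function of the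
image of `μ` under `ballCode`; the first coordinate selects the code. -/
noncomputable def ballParam (G : I × I → X) (μ : ProbabilityMeasure X) (p : I × I) : X :=
  G (p.1, unitQuantile ((μ : Measure X).map fun x => ballCode (p.1, x)) p.2)

theorem measurable_ballParam {G : I × I → X} (hG : Measurable G) {s : I → I × I}
    (hs : Measurable s) {Ω : Type*} [MeasurableSpace Ω] {m : Ω → ProbabilityMeasure X}
    (hm : ∀ B : Set X, MeasurableSet B → Measurable fun ω => (m ω : Measure X) B) :
    Measurable fun p : Ω × I => ballParam G (m p.1) (s p.2) := by
  have h1 : Measurable fun p : Ω × (I × I) => ballParam G (m p.1) p.2 :=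
    hG.comp (Measurable.prodMk (f := fun p : Ω × (I × I) => p.2.1)
      (measurable_fst.comp measurable_snd) (measurable_unitQuantile_map_ballCode hm))
  have h2 := h1.comp (measurable_fst.prodMk (hs.comp measurable_snd))
  rw [Function.comp_def] at h2
  exact h2

theorem measurable_ballParam_right {G : I × I → X} (hG : Measurable G)
    (μ : ProbabilityMeasure X) : Measurable (ballParam G μ) := by
  have h1 : Measurable fun p : Unit × (I × I) =>
      unitQuantile ((μ : Measure X).map fun x => ballCode (p.2.1, x)) p.2.2 :=
    measurable_unitQuantile_map_ballCode (m := fun _ => μ) fun B _ => measurable_const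
  have h2 := h1.comp (measurable_prodMk_left (x := ()))
  rw [Function.comp_def] at h2
  exact hG.comp (measurable_fst.prodMk h2)

end BallCode

/-! ### Weak topology and laws of random maps -/

/-- On open sets evaluation is lower semicontinuous, by the portmanteau theorem; open sets form a
generating π-system. -/
theorem ProbabilityMeasure.measurable_coe_apply_borel {X : Type*} [TopologicalSpace X]
    [HasOuterApproxClosed X] [MeasurableSpace X] [BorelSpace X] {B : Set X}
    (hB : MeasurableSet B) :
    Measurable[borel (ProbabilityMeasure X)] fun μ : ProbabilityMeasure X => (μ : Measure X) B := by
  let _ : MeasurableSpace (ProbabilityMeasure X) := borel _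
  have : BorelSpace (ProbabilityMeasure X) := ⟨rfl⟩
  have : Measurable fun μ : ProbabilityMeasure X => (μ : Measure X) := by
    refine Measurable.measure_of_isPiSystem_of_isProbabilityMeasure
      (BorelSpace.measurable_eq (α := X)) isPiSystem_isOpen fun G hG => ?_
    refine LowerSemicontinuous.measurable (lowerSemicontinuous_iff_le_liminf.2 fun μ => ?_)
    exact ProbabilityMeasure.le_liminf_measure_open_of_tendsto tendsto_id hG
  exact (Measure.measurable_coe hB).comp this

theorem tendsto_probabilityMeasure_of_ae_tendsto {X S : Type*} [TopologicalSpace X]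
    [MeasurableSpace X] [OpensMeasurableSpace X] [MeasurableSpace S] {P : Measure S}
    [IsProbabilityMeasure P] {μs : ℕ → ProbabilityMeasure X} {μ : ProbabilityMeasure X}
    {fs : ℕ → S → X} {f : S → X} (hfs : ∀ n, Measurable (fs n)) (hf : Measurable f)
    (hμs : ∀ n, P.map (fs n) = μs n) (hμ : P.map f = μ)
    (h : ∀ᵐ s ∂P, Tendsto (fun n => fs n s) atTop (𝓝 (f s))) : Tendsto μs atTop (𝓝 μ) := by
  have := (tendstoInDistribution_of_ae_tendsto (fun n => (hfs n).aemeasurable)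
    hf.aemeasurable h).tendsto
  have h1 : (fun n => (⟨P.map (fs n), Measure.isProbabilityMeasure_map (hfs n).aemeasurable⟩ :
      ProbabilityMeasure X)) = μs := funext fun n => Subtype.ext (hμs n)
  have h2 : (⟨P.map f, Measure.isProbabilityMeasure_map hf.aemeasurable⟩ :
      ProbabilityMeasure X) = μ := Subtype.ext hμ
  rw [← h1, ← h2]
  exact this

theorem MeasureTheory.Measure.map_prod_eq_of_forall {R T Y : Type*} [MeasurableSpace R]
    [MeasurableSpace T] [MeasurableSpace Y] {P : Measure R} [IsProbabilityMeasure P]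
    {Q : Measure T} [SFinite Q] {μ : Measure Y} {f : R × T → Y} (hf : Measurable f)
    (h : ∀ r, Q.map (fun t => f (r, t)) = μ) : (P.prod Q).map f = μ := by
  ext B hB
  rw [Measure.map_apply hf hB, Measure.prod_apply (hf hB)]
  have : ∀ r, Q (Prod.mk r ⁻¹' (f ⁻¹' B)) = μ B := fun r => by
    rw [← h r, Measure.map_apply (f := fun t => f (r, t)) (hf.comp measurable_prodMk_left) hB]
    rfl
  simp [this]

/-! ### Assembly of the parametrization -/

theorem mainTheorem6 {X : Type*} [MetricSpace X] [CompleteSpace X]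
    [TopologicalSpace.SeparableSpace X] [MeasurableSpace X] [BorelSpace X] :
    ∃ ξ : ProbabilityMeasure X → I → X,
      -- each `ξ μ` is Borel and transports Lebesgue measure on `[0,1]` to `μ`
      (∀ μ : ProbabilityMeasure X,
        Measurable (ξ μ) ∧ (volume : Measure I).map (ξ μ) = (μ : Measure X)) ∧
      -- `(μ, t) ↦ ξ μ t` is Borel on `𝒫(X) × [0,1]`, where `𝒫(X)` has the weak topology
      Measurable[borel (ProbabilityMeasure X × I)]
        (fun p : ProbabilityMeasure X × I => ξ p.1 p.2) ∧
      -- weak convergence is a.e. convergence of the parametrizations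
      (∀ (μs : ℕ → ProbabilityMeasure X) (μ : ProbabilityMeasure X),
        Tendsto μs atTop (𝓝 μ) ↔
          ∀ᵐ t ∂(volume : Measure I), Tendsto (fun n => ξ (μs n) t) atTop (𝓝 (ξ μ t))) ∧
      -- joint measurability for every measurable family of probability measures
      (∀ {Ω : Type*} [MeasurableSpace Ω] (m : Ω → ProbabilityMeasure X),
        (∀ B : Set X, MeasurableSet B → Measurable (fun ω => (m ω : Measure X) B)) →
          Measurable (fun p : Ω × I => ξ (m p.1) p.2)) := by
  rcases isEmpty_or_nonempty X with hX | hX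
  · have hE : IsEmpty (ProbabilityMeasure X) :=
      ⟨fun μ => not_isEmpty_of_nonempty X (h := nonempty_of_isProbabilityMeasure (μ : Measure X)) hX⟩
    exact ⟨fun μ => hE.elim μ, fun μ => hE.elim μ, @measurable_of_empty _ _ (borel _) _ _ _,
      fun _ μ => hE.elim μ, fun m _ => by
        have := m.isEmpty
        exact measurable_of_empty _⟩
  have : SecondCountableTopology X := UniformSpace.secondCountable_of_separable X
  obtain ⟨G, hG, hGc⟩ := exists_measurable_ballDecode (X := X)
  obtain ⟨s, hs, hsv⟩ := Measure.exists_measurable_map_eq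
    ((volume : Measure I).prod (volume : Measure I))
  let Q : ProbabilityMeasure X → I × I → I := fun μ p =>
    unitQuantile ((μ : Measure X).map fun x => ballCode (p.1, x)) p.2
  let η : ProbabilityMeasure X → I × I → X := ballParam G
  have hη : ∀ μ, Measurable (η μ) := measurable_ballParam_right hG
  have hQlaw : ∀ (μ : ProbabilityMeasure X) (r : I), (volume : Measure I).map
      (unitQuantile ((μ : Measure X).map fun x => ballCode (r, x))) =
        (μ : Measure X).map fun x => ballCode (r, x) := fun μ r => map_unitQuantile _
  have hQm : ∀ (μ : ProbabilityMeasure X) (r : I),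
      Measurable (unitQuantile ((μ : Measure X).map fun x => ballCode (r, x))) :=
    fun μ r => (unitQuantile_mono _).measurable
  have hGr : ∀ r, Measurable fun y => G (r, y) := fun r => hG.comp measurable_prodMk_left
  have hηlaw : ∀ μ : ProbabilityMeasure X,
      ((volume : Measure I).prod (volume : Measure I)).map (η μ) = μ := by
    refine fun μ => Measure.map_prod_eq_of_forall (hη μ) fun r => ?_
    have h1 := Measure.map_map (μ := (volume : Measure I)) (hGr r) (hQm μ r)
    rw [hQlaw, Measure.map_map (hGr r) (measurable_ballCode_right r)] at h1
    have h2 : (fun y => G (r, y)) ∘ (fun x : X => ballCode (r, x)) = id :=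
      funext fun x => hGc r x
    rw [h2, Measure.map_id] at h1
    exact h1.symm
  -- `G` inverts the code only on its image; the quantile lands where coding undoes `G` for a.e.
  -- `t`, since its law is a pushforward under the code.
  have hsection : ∀ (μ : ProbabilityMeasure X) (r : I), ∀ᵐ t ∂(volume : Measure I),
      ballCode (r, η μ (r, t)) = Q μ (r, t) := by
    intro μ r
    have hS : MeasurableSet {y : I | ballCode (r, G (r, y)) = y} :=
      measurableSet_eq_fun ((measurable_ballCode_right r).comp (hGr r)) measurable_id
    refine ae_of_ae_map (hQm μ r).aemeasurable (p := fun y => ballCode (r, G (r, y)) = y) ?_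
    rw [hQlaw, ae_map_iff (measurable_ballCode_right r).aemeasurable hS]
    exact ae_of_all _ fun x => by rw [hGc]
  have hlaw : ∀ μ : ProbabilityMeasure X,
      (volume : Measure I).map (fun t => η μ (s t)) = (μ : Measure X) := fun μ => by
    rw [← hηlaw μ, ← hsv, Measure.map_map (hη μ) hs]
    rfl
  refine ⟨fun μ t => η μ (s t), fun μ => ⟨(hη μ).comp hs, hlaw μ⟩, ?_, fun μs μ => ⟨fun h => ?_,
    tendsto_probabilityMeasure_of_ae_tendsto (fun n => (hη _).comp hs) ((hη μ).comp hs)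
      (fun n => hlaw _) (hlaw μ)⟩,
    fun m hm => measurable_ballParam hG hs hm⟩
  · let _ : MeasurableSpace (ProbabilityMeasure X) := borel _
    have : BorelSpace (ProbabilityMeasure X) := ⟨rfl⟩
    have h := measurable_ballParam hG hs (m := fun μ : ProbabilityMeasure X => μ)
      fun B hB => ProbabilityMeasure.measurable_coe_apply_borel hB
    exact h.mono prod_le_borel_prod le_rfl
  · have hS : MeasurableSet {p : I × I | Tendsto (fun n => η (μs n) p) atTop (𝓝 (η μ p))} :=
      measurableSet_tendsto_fun (fun n => hη (μs n)) (hη μ)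
    refine ae_of_ae_map hs.aemeasurable
      (p := fun p => Tendsto (fun n => η (μs n) p) atTop (𝓝 (η μ p))) ?_
    rw [hsv, Measure.ae_prod_iff_ae_ae hS]
    -- Only the limit `μ` restricts `r`; the `μs n` merely contribute countably many null sets of
    -- `t`.
    filter_upwards [ae_ae_continuousAt_ballCode (μ : Measure X)] with r hr
    filter_upwards [ae_tendsto_unitQuantile_map h (measurable_ballCode_right r) hr,
      hsection μ r, ae_all_iff.2 fun n => hsection (μs n) r] with t ht ht0 htn
    refine tendsto_of_tendsto_ballCode (r := r) ?_
    rw [ht0]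
    simp only [htn]
    exact ht
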